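/- **Setting.** Let $M\ge 2$ be an integer and let $\tau_1,\dots,\tau_N$ be sporadic tasks, where $\tau_i$ has worst-case execution time $C_i>0$, relative deadline $D_i>0$ and minimum inter-arrival time $T_i>0$, with $C_i\le D_i$ and utilization $U_i=C_i/T_i\le 1$ (deadlines are arbitrary: $D_i>T_i$ is allowed). Jobs of $\tau_i$ arrive at least $T_i$ time units apart, each needs at most $C_i$ units of execution, and a job that arrives at time $r$ has deadline $r+D_i$. The jobs are executed on $M$ identical unit-speed processors by global fixed-priority preemptive scheduling, where $\tau_i$ has higher priority than $\tau_j$ if $i<j$: at every instant at most one job of each task is executed, on at most one processor; jobs of the same task are executed in the order of their arrivals; and a task with an unfinished job is executed unless all $M$ processors are executing jobs of higher-priority tasks. A task is *schedulable* if all its jobs meet their deadlines in every such schedule of every job sequence that the tasks may generate. For $t\ge 0$ put $work_i(t)=\lfloor t/T_i\rfloor C_i+\min\{C_i,\;t-\lfloor t/T_i\rfloor T_i\}$. For $\Delta>0$ and $0<\rho\le 1$ put $\omega_i^{heavy}(\Delta)=work_i(\Delta+D_i)$, $$\omega_i^{light}(\Delta,\rho)=\begin{cases}\Delta & \text{if }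 0<\Delta\le C_i,\\ \max\{work_i(\Delta),\;(p_2+1)C_i+\max\{0,\,C_i-\rho(T_i-q_2)\}\} & \text{if }\Delta>C_i,\end{cases}$$ where $p_2=\lceil(\Delta-C_i)/T_i\rceil-1$ and $q_2=\Delta-C_i-p_2T_i$, and $$\omega_i^{diff}(\Delta,\rho)=\begin{cases}\omega_i^{heavy}(\Delta)-work_i(\Delta) & \text{if } U_i>\rho,\\ \omega_i^{light}(\Delta,\rho)-work_i(\Delta) & \text{if } U_i\le\rho.\end{cases}$$ **Theorem 3.10.** Let $1\le k\le N$ and suppose that the higher-priority tasks $\tau_1,\dots,\tau_{k-1}$ are schedulable. Then $\tau_k$ is schedulable if for every integer $\ell\ge 1$ there is $\rho$ with $\frac{\ell C_k}{(\ell-1)T_k+D_k}\le\rho\le 1$ such that for all real $\Delta\ge(\ell-1)T_k+D_k$ $$\ell C_k+\sum_{\tau_i\in\mathbf T^{carry}}\omega_i^{diff}(\Delta,\rho)+\sum_{i=1}^{k-1}work_i(\Delta)\;\le\;\Delta\cdot\mu_k,$$ where $\mu_k=M-(M-1)\rho$ and $\mathbf T^{carry}$ is the set of the $\lceil\mu_k\rceil-1$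 tasks with the largest values of $\omega_i^{diff}(\Delta,\rho)$ among the $k-1$ higher-priority tasks $\tau_1,\dots,\tau_{k-1}$ (all of them, if $k-1<\lceil\mu_k\rceil-1$; ties are broken arbitrarily). If $D_k\le T_k$, it is enough that this condition holds for $\ell=1$. -/

import Mathlib

open MeasureTheory

noncomputable section

namespace GlobalFP

/-- A sporadic task: worst-case execution time `C`, relative deadline `D`, minimum
inter-arrival time `T`.  The deadline is arbitrary (`D < T`, `D = T` and `D > T` are all allowed);
`C ≤ T` says that the utilization is at most one. -/
structure SporadicTask where
  C : ℝ
  D : ℝ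
  T : ℝ
  C_pos : 0 < C
  D_pos : 0 < D
  T_pos : 0 < T
  C_le_D : C ≤ D
  C_le_T : C ≤ T

/-- The utilization `U = C / T` of a task. -/
def SporadicTask.U (τ : SporadicTask) : ℝ := τ.C / τ.T

/-- The workload function `⌊t/T⌋ C + min {C, t - ⌊t/T⌋ T}` (used for `t ≥ 0` only). -/
def SporadicTask.work (τ : SporadicTask) (t : ℝ) : ℝ :=
  (⌊t / τ.T⌋ : ℝ) * τ.C + min τ.C (t - (⌊t / τ.T⌋ : ℝ) * τ.T)

/-- Carry-in workload bound of a heavy task (used for `Δ > 0` only). -/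
def SporadicTask.omegaHeavy (τ : SporadicTask) (Δ : ℝ) : ℝ := τ.work (Δ + τ.D)

/-- Carry-in workload bound of a light task (used for `Δ > 0` only), with
`p₂ = ⌈(Δ - C)/T⌉ - 1` and `q₂ = Δ - C - p₂ T`. -/
def SporadicTask.omegaLight (τ : SporadicTask) (Δ ρ : ℝ) : ℝ :=
  if Δ ≤ τ.C then Δ
  else
    let p₂ : ℝ := (⌈(Δ - τ.C) / τ.T⌉ : ℝ) - 1
    let q₂ : ℝ := Δ - τ.C - p₂ * τ.T
    max (τ.work Δ) ((p₂ + 1) * τ.C + max 0 (τ.C - ρ * (τ.T - q₂)))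

open Classical in
/-- The additional workload that a task may contribute as a carry-in task. -/
def SporadicTask.omegaDiff (τ : SporadicTask) (Δ ρ : ℝ) : ℝ :=
  if τ.U > ρ then τ.omegaHeavy Δ - τ.work Δ else τ.omegaLight Δ ρ - τ.work Δ

variable {N : ℕ}

/-- A job sequence that the sporadic tasks `τ 0, …, τ (N-1)` may generate.  Job `n` of task `i`
arrives at time `release i n`, needs `exec i n ≤ C i` units of execution, and has the absolute
deadline `release i n + D i`.  Consecutive jobs of a task arrive at least `T i` apart.
(A job with `exec i n = 0` is the same as no job.) -/
structure JobSequence (τ : Fin N → SporadicTask) where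
  release : Fin N → ℕ → ℝ
  exec : Fin N → ℕ → ℝ
  release_succ : ∀ i n, release i n + (τ i).T ≤ release i (n + 1)
  exec_nonneg : ∀ i n, 0 ≤ exec i n
  exec_le : ∀ i n, exec i n ≤ (τ i).C

/-- An assignment of jobs to `M` processors over time: `σ p t = some (i, n)` means that processor
`p` executes job `n` of task `i` at time `t`, and `σ p t = none` that it idles. -/
abbrev Assignment (M N : ℕ) := Fin M → ℝ → Option (Fin N × ℕ)

section Schedule

variable {M : ℕ} {τ : Fin N → SporadicTask} (J : JobSequence τ) (σ : Assignment M N)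

/-- The amount of execution that job `n` of task `i` receives from its arrival up to time `t`. -/
def service (i : Fin N) (n : ℕ) (t : ℝ) : ℝ :=
  volume.real {s : ℝ | s ∈ Set.Ico (J.release i n) t ∧ ∃ p, σ p s = some (i, n)}

/-- Job `n` of task `i` has arrived before or at time `t` and has not finished yet at `t`. -/
def Pending (i : Fin N) (n : ℕ) (t : ℝ) : Prop :=
  J.release i n ≤ t ∧ service J σ i n t < J.exec i n

/-- Task `i` is active at time `t`. -/
def Active (i : Fin N) (t : ℝ) : Prop := ∃ n, Pending J σ i n t

/-- `σ` is a schedule of the job sequence `J` under global fixed-priority preemptive scheduling on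
`M` identical unit-speed processors; task `i` has higher priority than task `j` if `i < j`. -/
structure IsGlobalFPSchedule : Prop where
  measurable : ∀ p i n, MeasurableSet {t : ℝ | σ p t = some (i, n)}
  /-- Only jobs that have arrived and have not finished are executed. -/
  pending_of_run : ∀ p t i n, σ p t = some (i, n) → Pending J σ i n t
  /-- No intra-task parallelism: at each instant at most one job of a task is executed, on at most
  one processor. -/
  sequential : ∀ p q t i n m, σ p t = some (i, n) → σ q t = some (i, m) → p = q
  /-- Jobs of the same task are executed in the order of their arrivals. -/
  fifo : ∀ p t i n m, σ p t = some (i, n) → m < n → ¬ Pending J σ i m t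
  /-- An active task is executed unless all processors execute higher-priority tasks. -/
  priority : ∀ i t, Active J σ i t →
    (∃ p n, σ p t = some (i, n)) ∨ ∀ p, ∃ j m, j < i ∧ σ p t = some (j, m)

/-- Every job of task `i` receives its whole execution by its deadline. -/
def MeetsDeadlines (i : Fin N) : Prop :=
  ∀ n, J.exec i n ≤ service J σ i n (J.release i n + (τ i).D)

end Schedule

/-- Task `i` is schedulable under global fixed-priority preemptive scheduling on `M` processors:
it meets all its deadlines, whatever jobs the tasks generate. -/
def Schedulable (M : ℕ) (τ : Fin N → SporadicTask) (i : Fin N) : Prop :=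
  ∀ (J : JobSequence τ) (σ : Assignment M N), IsGlobalFPSchedule J σ → MeetsDeadlines J σ i

/-- `μ = M - (M - 1) ρ`. -/
def mu (M : ℕ) (ρ : ℝ) : ℝ := (M : ℝ) - ((M : ℝ) - 1) * ρ

/-- `S` consists of the `⌈μ⌉ - 1` tasks with the largest values of `omegaDiff` among the tasks of
higher priority than `k` (of all of them, if there are fewer than `⌈μ⌉ - 1`). -/
def IsCarrySet (M : ℕ) (τ : Fin N → SporadicTask) (k : Fin N) (Δ ρ : ℝ) (S : Finset (Fin N)) :
    Prop :=
  S ⊆ Finset.Iio k ∧ S.card = min (⌈mu M ρ⌉₊ - 1) (Finset.Iio k).card ∧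
    ∀ i ∈ S, ∀ j ∈ Finset.Iio k \ S, (τ j).omegaDiff Δ ρ ≤ (τ i).omegaDiff Δ ρ

/-- The schedulability condition for task `k` and a fixed `ℓ`. -/
def TestCondition (M : ℕ) (τ : Fin N → SporadicTask) (k : Fin N) (ℓ : ℕ) : Prop :=
  ∃ ρ : ℝ, (ℓ : ℝ) * (τ k).C / (((ℓ : ℝ) - 1) * (τ k).T + (τ k).D) ≤ ρ ∧ ρ ≤ 1 ∧
    ∀ Δ : ℝ, ((ℓ : ℝ) - 1) * (τ k).T + (τ k).D ≤ Δ →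
      ∃ S : Finset (Fin N), IsCarrySet M τ k Δ ρ S ∧
        (ℓ : ℝ) * (τ k).C + ∑ i ∈ S, (τ i).omegaDiff Δ ρ + ∑ i ∈ Finset.Iio k, (τ i).work Δ
          ≤ Δ * mu M ρ

end GlobalFP

end

namespace GlobalFP

/-! ### The workload functions of a single task. -/

namespace SporadicTask

variable (τ : SporadicTask)

/-! Suppose a job of task `k` misses its deadline `d`. Let `r` start a busy period of `k` reaching
up to `d`, with `ℓ` jobs up to this one. On `[r, d)` task `k` executes for less than `ℓ C ≤ ρ (d -
r)`, and whenever it does not execute, all `M` processors serve higher-priority tasks. Hence the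
higher-priority execution plus `ℓ C` exceeds `μ (d - r)`.

Extend the window to the left, to the earliest `t₀ ≤ r` that maximizes the surplus of
higher-priority execution over the rate `μ` (`exists_maximal_extension`). The inequality survives on
`[t₀, d)`, while every window ending at `t₀` lies strictly below the rate `μ`. This deficit has two
effects: fewer than `μ` tasks carry work into `t₀` (`card_lt_of_hasCarryIn`), and a light carry-in
task has already executed at rate at least `ρ` since its busy period began
(`executed_le_omegaLight`). Heavy carry-in tasks are bounded through their deadlines, the others by
`work`. The sum of these bounds contradicts the test at `Δ = d - t₀`.

If `D ≤ T`, induction on the jobs shows that earlier jobs are finished at each release, so `ℓ = 1`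
suffices. -/

theorem rem_nonneg (t : ℝ) : 0 ≤ t - (⌊t / τ.T⌋ : ℝ) * τ.T := by
  have h := Int.floor_le (t / τ.T)
  rw [le_div_iff₀ τ.T_pos] at h
  linarith

theorem rem_lt (t : ℝ) : t - (⌊t / τ.T⌋ : ℝ) * τ.T < τ.T := by
  have h := Int.lt_floor_add_one (t / τ.T)
  rw [div_lt_iff₀ τ.T_pos] at h
  linarith

theorem work_mono {s t : ℝ} (h : s ≤ t) : τ.work s ≤ τ.work t := by
  unfold work
  have hC := τ.C_pos
  have hK : ⌊s / τ.T⌋ ≤ ⌊t / τ.T⌋ :=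
    Int.floor_le_floor (div_le_div_of_nonneg_right h τ.T_pos.le)
  rcases hK.eq_or_lt with hK | hK
  · rw [hK]
    gcongr
  · have h1 : (⌊s / τ.T⌋ : ℝ) + 1 ≤ ⌊t / τ.T⌋ := by exact_mod_cast hK
    have h2 : 0 ≤ min τ.C (t - (⌊t / τ.T⌋ : ℝ) * τ.T) := le_min hC.le (τ.rem_nonneg t)
    have h3 := min_le_left τ.C (s - (⌊s / τ.T⌋ : ℝ) * τ.T)
    nlinarith

theorem work_eq_self {t : ℝ} (h0 : 0 ≤ t) (h : t ≤ τ.C) : τ.work t = t := by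
  unfold work
  have hT := τ.T_pos
  -- The corner case `t = C = T` has floor one and remainder zero.
  rcases (h.trans τ.C_le_T).eq_or_lt with hT' | hT'
  · have hC : τ.C = τ.T := le_antisymm τ.C_le_T (hT' ▸ h)
    have : t / τ.T = 1 := by rw [hT']; exact div_self hT.ne'
    rw [this, hC, hT']
    simp [hT.le]
  · have : ⌊t / τ.T⌋ = 0 := by
      rw [Int.floor_eq_zero_iff]
      exact ⟨by positivity, (div_lt_one hT).2 hT'⟩
    rw [this]
    simp [h]

/-- Extending a window of length `Δ` to the left by `L`, while discounting execution at rate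
`ρ ≥ U` in the extension, does not exceed the light carry-in bound. -/
theorem work_add_le_omegaLight {Δ ρ L : ℝ} (hΔ : τ.C < Δ) (hL : 0 ≤ L) (hU : τ.U ≤ ρ)
    (hρ : ρ ≤ 1) : τ.work (Δ + L) - ρ * L ≤ τ.omegaLight Δ ρ := by
  have hT := τ.T_pos
  have hC := τ.C_pos
  have hρ0 : 0 < ρ := (div_pos hC hT).trans_le hU
  have hCT : τ.C ≤ ρ * τ.T := (div_le_iff₀ hT).1 hU
  unfold omegaLight
  rw [if_neg (not_le.2 hΔ)]
  refine le_trans ?_ (le_max_right _ _)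
  have hn := Int.ceil_lt_add_one ((Δ - τ.C) / τ.T)
  rw [← sub_lt_iff_lt_add, lt_div_iff₀ hT] at hn
  have hy0 := τ.rem_nonneg (Δ + L)
  have hyT := τ.rem_lt (Δ + L)
  unfold work
  generalize ⌊(Δ + L) / τ.T⌋ = K at *
  generalize ⌈(Δ - τ.C) / τ.T⌉ = n at *
  have hm1 := min_le_left τ.C (Δ + L - (K : ℝ) * τ.T)
  have hm2 := min_le_right τ.C (Δ + L - (K : ℝ) * τ.T)
  have hmaxl := le_max_left 0 (τ.C - ρ * (τ.T - (Δ - τ.C - ((n : ℝ) - 1) * τ.T)))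
  have hmaxr := le_max_right 0 (τ.C - ρ * (τ.T - (Δ - τ.C - ((n : ℝ) - 1) * τ.T)))
  generalize max 0 (τ.C - ρ * (τ.T - (Δ - τ.C - ((n : ℝ) - 1) * τ.T))) = z at *
  -- Here `n = p₂ + 1`. If `K < n`, the at most `K + 1` full jobs already fit into `n C`.
  rcases lt_or_ge K n with hK | hK
  · have hK' : (K : ℝ) + 1 ≤ n := by exact_mod_cast hK
    have := mul_le_mul_of_nonneg_right hK' hC.le
    have := mul_nonneg hρ0.le hL
    linarith
  · have hK' : (0 : ℝ) ≤ K - n := by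
      have : (n : ℝ) ≤ K := by exact_mod_cast hK
      linarith
    -- Each whole period beyond `n` gains `C` and costs `ρ T ≥ C`. For the remainder `y`, `min C y -
    -- ρ y` is largest at `y = C`, since `0 < ρ ≤ 1`.
    have h1 := mul_nonneg hK' (sub_nonneg.2 hCT)
    have h2 : min τ.C (Δ + L - (K : ℝ) * τ.T) - ρ * (Δ + L - (K : ℝ) * τ.T)
        ≤ τ.C - ρ * τ.C := by
      rcases le_total (Δ + L - (K : ℝ) * τ.T) τ.C with h | h
      · have := mul_le_mul_of_nonneg_left h (sub_nonneg.2 hρ)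
        linarith
      · have := mul_le_mul_of_nonneg_left h hρ0.le
        linarith
    linarith

theorem omegaDiff_nonneg {Δ ρ : ℝ} (hΔ : 0 ≤ Δ) : 0 ≤ τ.omegaDiff Δ ρ := by
  unfold omegaDiff
  split_ifs with h
  · exact sub_nonneg.2 (τ.work_mono (by linarith [τ.D_pos]))
  · unfold omegaLight
    split_ifs with h'
    · rw [τ.work_eq_self hΔ h', sub_self]
    · exact sub_nonneg.2 (le_max_left _ _)

end SporadicTask

/-! ### Execution and service as functions of time. -/

/-- The instants at which task `i` is executed. -/
def runSet {M N : ℕ} (σ : Assignment M N) (i : Fin N) : Set ℝ := {s | ∃ p n, σ p s = some (i, n)}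

/-- The amount of execution that task `i` receives in `[a, b)`. -/
noncomputable def executed {M N : ℕ} (σ : Assignment M N) (i : Fin N) (a b : ℝ) : ℝ :=
  volume.real (runSet σ i ∩ Set.Ico a b)

theorem measureReal_le_of_subset_Ico {A : Set ℝ} {a b : ℝ} (hab : a ≤ b) (h : A ⊆ Set.Ico a b) :
    volume.real A ≤ b - a := by
  refine (measureReal_mono h (by simp)).trans ?_
  simp [hab]

section Schedule

variable {M N : ℕ} {τ : Fin N → SporadicTask} {J : JobSequence τ} {σ : Assignment M N}

theorem measureReal_inter_Ico_ne_top (A : Set ℝ) (a b : ℝ) : volume (A ∩ Set.Ico a b) ≠ ⊤ :=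
  measure_ne_top_of_subset Set.inter_subset_right (by simp)

theorem executed_le (i : Fin N) {a b : ℝ} (hab : a ≤ b) : executed σ i a b ≤ b - a :=
  measureReal_le_of_subset_Ico hab Set.inter_subset_right

theorem executed_continuous (σ : Assignment M N) (i : Fin N) (a : ℝ) :
    Continuous (executed σ i a) := by
  have hmono : Monotone (executed σ i a) := fun x y hxy =>
    measureReal_mono (Set.inter_subset_inter_right _ (Set.Ico_subset_Ico_right hxy))
      (measureReal_inter_Ico_ne_top _ _ _)
  have hadd : ∀ x y, x ≤ y → executed σ i a y ≤ executed σ i a x + (y - x) := by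
    intro x y hxy
    have hsub : runSet σ i ∩ Set.Ico a y ⊆ (runSet σ i ∩ Set.Ico a x) ∪ Set.Ico x y := by
      rintro s ⟨h1, h2, h3⟩
      rcases lt_or_ge s x with h | h
      · exact Or.inl ⟨h1, h2, h⟩
      · exact Or.inr ⟨h, h3⟩
    refine (measureReal_mono hsub
      (measure_union_ne_top (measureReal_inter_Ico_ne_top _ _ _) (by simp))).trans ?_
    refine (measureReal_union_le _ _).trans ?_
    simp [executed, hxy]
  refine (LipschitzWith.of_le_add fun x y => ?_).continuous
  rw [Real.dist_eq]
  rcases le_total x y with h | h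
  · exact (hmono h).trans (by linarith [abs_nonneg (x - y)])
  · exact (hadd y x h).trans (by linarith [le_abs_self (x - y)])

theorem release_add_le (J : JobSequence τ) (i : Fin N) (n c : ℕ) :
    J.release i n + c * (τ i).T ≤ J.release i (n + c) := by
  induction c with
  | zero => simp
  | succ c ih =>
    have := J.release_succ i (n + c)
    push_cast
    rw [← add_assoc]
    linarith

theorem release_mono (J : JobSequence τ) (i : Fin N) : Monotone (J.release i) :=
  monotone_nat_of_le_succ fun n => by linarith [J.release_succ i n, (τ i).T_pos]

theorem service_mono (J : JobSequence τ) (σ : Assignment M N) (i : Fin N) (n : ℕ) :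
    Monotone (service J σ i n) := fun a b hab =>
  measureReal_mono (fun _ hs => ⟨⟨hs.1.1, hs.1.2.trans_le hab⟩, hs.2⟩)
    (measure_ne_top_of_subset (fun _ hs => hs.1) (by simp : volume (Set.Ico (J.release i n) b) ≠ ⊤))

theorem service_le_add (J : JobSequence τ) (σ : Assignment M N) (i : Fin N) (n : ℕ) {a b : ℝ}
    (hab : a ≤ b) : service J σ i n b ≤ service J σ i n a + (b - a) := by
  have h : {s : ℝ | s ∈ Set.Ico (J.release i n) b ∧ ∃ p, σ p s = some (i, n)} ⊆
      {s : ℝ | s ∈ Set.Ico (J.release i n) a ∧ ∃ p, σ p s = some (i, n)} ∪ Set.Ico a b := by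
    rintro s ⟨⟨h1, h2⟩, h3⟩
    rcases lt_or_ge s a with h | h
    · exact Or.inl ⟨⟨h1, h⟩, h3⟩
    · exact Or.inr ⟨h, h2⟩
  have hfin : volume ({s : ℝ | s ∈ Set.Ico (J.release i n) a ∧ ∃ p, σ p s = some (i, n)}) ≠ ⊤ :=
    measure_ne_top_of_subset (fun _ hs => hs.1) (by simp : volume (Set.Ico (J.release i n) a) ≠ ⊤)
  refine (measureReal_mono h (measure_union_ne_top hfin (by simp))).trans ?_
  refine (measureReal_union_le _ _).trans ?_
  simp [service, hab]

theorem service_continuous (J : JobSequence τ) (σ : Assignment M N) (i : Fin N) (n : ℕ) :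
    Continuous (service J σ i n) := by
  refine (LipschitzWith.of_le_add fun x y => ?_).continuous
  rw [Real.dist_eq]
  rcases le_total x y with h | h
  · exact (service_mono J σ i n h).trans (by linarith [abs_nonneg (x - y)])
  · exact (service_le_add J σ i n h).trans (by linarith [le_abs_self (x - y)])

theorem service_release (J : JobSequence τ) (σ : Assignment M N) (i : Fin N) (n : ℕ) :
    service J σ i n (J.release i n) = 0 := by
  simp [service]

/-! ### Carry-in, busy periods and counting of tasks. -/

/-- Task `i` has, at time `t`, an unfinished job that was released before `t`. -/
def HasCarryIn (J : JobSequence τ) (σ : Assignment M N) (i : Fin N) (t : ℝ) : Prop :=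
  ∃ n, J.release i n < t ∧ Pending J σ i n t

/-- A job that is pending throughout `[release, b)` belongs to a busy period, which starts with the
release of a job before which all earlier jobs have finished. -/
theorem exists_busy_period (J : JobSequence τ) (σ : Assignment M N) (i : Fin N) (n : ℕ) {b : ℝ}
    (hn : ∀ t, J.release i n ≤ t → t < b → Pending J σ i n t) :
    ∃ m ≤ n, (∀ j < m, ¬ Pending J σ i j (J.release i m)) ∧
      ∀ t, J.release i m ≤ t → t < b → Active J σ i t := by
  classical
  let P : ℕ → Prop := fun m => ∀ j < m, ¬ Pending J σ i j (J.release i m)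
  have hP0 : P 0 := fun j hj => absurd hj (Nat.not_lt_zero j)
  refine ⟨Nat.findGreatest P n, Nat.findGreatest_le n,
    Nat.findGreatest_spec (P := P) (Nat.zero_le n) hP0, fun t hmt htb => ?_⟩
  set m := Nat.findGreatest P n
  by_cases hnt : J.release i n ≤ t
  · exact ⟨n, hn t hnt htb⟩
  have hex : ∃ q, t < J.release i q := ⟨n, not_le.1 hnt⟩
  set q := Nat.find hex
  have hq : t < J.release i q := Nat.find_spec hex
  have hqn : q ≤ n := Nat.find_min' hex (not_le.1 hnt)
  have hmq : m < q := by
    by_contra! hle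
    linarith [release_mono J i hle]
  -- `q` is the first job released after `t`. By maximality of `m`, some earlier job is still
  -- pending at its release; by minimality of `q`, that job was released by `t`.
  have hnP : ¬ P q := Nat.findGreatest_is_greatest hmq hqn
  simp only [P] at hnP
  push Not at hnP
  obtain ⟨j, hj, hjp⟩ := hnP
  refine ⟨j, not_lt.1 (Nat.find_min hex hj), ?_⟩
  exact (service_mono J σ i j hq.le).trans_lt hjp.2

/-- The number of tasks in `A` that are executed at `s`. -/
theorem sum_indicator_eq_card (A : Finset (Fin N)) (s : ℝ) [DecidablePred fun i => s ∈ runSet σ i] :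
    ∑ i ∈ A, (runSet σ i).indicator (fun _ => (1 : ℝ)) s = (A.filter fun i => s ∈ runSet σ i).card := by
  simp [Set.indicator_apply]

theorem card_le_sum_indicator (k : Fin N) (B : Finset (Fin N)) (hB : B ⊆ Finset.Iio k) {s : ℝ}
    (hs : ∀ i ∈ B, s ∈ runSet σ i) :
    (B.card : ℝ) ≤ ∑ i ∈ Finset.Iio k, (runSet σ i).indicator (fun _ => (1 : ℝ)) s := by
  classical
  rw [sum_indicator_eq_card, Nat.cast_le]
  exact Finset.card_le_card fun i hi => Finset.mem_filter.2 ⟨hB hi, hs i hi⟩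

/-- The total carry-in excess is bounded by that of a carry set. -/
theorem IsCarrySet.sum_le {k : Fin N} {Δ ρ : ℝ} {S A : Finset (Fin N)}
    (hS : IsCarrySet M τ k Δ ρ S) (hΔ : 0 ≤ Δ) (hA : A ⊆ Finset.Iio k)
    (hcard : A.card ≤ ⌈mu M ρ⌉₊ - 1) :
    ∑ i ∈ A, (τ i).omegaDiff Δ ρ ≤ ∑ i ∈ S, (τ i).omegaDiff Δ ρ := by
  classical
  obtain ⟨-, hSc, hSm⟩ := hS
  have hAS : A.card ≤ S.card := hSc ▸ le_min hcard (Finset.card_le_card hA)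
  have h0 : ∀ i, 0 ≤ (τ i).omegaDiff Δ ρ := fun i => (τ i).omegaDiff_nonneg hΔ
  -- Common tasks cancel. Every task of `S \ A` dominates the largest one of `A \ S`, and there are
  -- at least as many of them.
  have hdiff : (A \ S).card ≤ (S \ A).card := by
    have h1 := Finset.card_sdiff_add_card_inter A S
    have h2 := Finset.card_sdiff_add_card_inter S A
    rw [Finset.inter_comm] at h2
    omega
  rw [← Finset.sum_inter_add_sum_sdiff A S, ← Finset.sum_inter_add_sum_sdiff S A,
    Finset.inter_comm S A]
  refine add_le_add le_rfl ?_
  rcases (A \ S).eq_empty_or_nonempty with hE | hE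
  · rw [hE, Finset.sum_empty]
    exact Finset.sum_nonneg fun i _ => h0 i
  obtain ⟨q, hqA, hq⟩ := (A \ S).exists_max_image (fun i => (τ i).omegaDiff Δ ρ) hE
  have hq' := Finset.mem_sdiff.1 hqA
  calc ∑ i ∈ A \ S, (τ i).omegaDiff Δ ρ ≤ (A \ S).card • (τ q).omegaDiff Δ ρ :=
        Finset.sum_le_card_nsmul _ _ _ hq
    _ ≤ (S \ A).card • (τ q).omegaDiff Δ ρ := nsmul_le_nsmul_left (h0 q) hdiff
    _ ≤ ∑ i ∈ S \ A, (τ i).omegaDiff Δ ρ := Finset.card_nsmul_le_sum _ _ _ fun i hi =>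
        hSm i (Finset.mem_sdiff.1 hi).1 q (Finset.mem_sdiff.2 ⟨hA hq'.1, hq'.2⟩)

/-! ### Consequences of the scheduling rules. -/

namespace IsGlobalFPSchedule

theorem measurableSet_runSet (h : IsGlobalFPSchedule J σ) (i : Fin N) :
    MeasurableSet (runSet σ i) := by
  have : runSet σ i = ⋃ p, ⋃ n, {t | σ p t = some (i, n)} := by
    ext; simp [runSet]
  rw [this]
  exact MeasurableSet.iUnion fun p => MeasurableSet.iUnion fun n => h.measurable p i n

/-- By continuity an overshoot would pass through an instant `u` of exact completion, and a finished
job does not run after `u`. -/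
theorem service_le_exec (h : IsGlobalFPSchedule J σ) (i : Fin N) (n : ℕ) (t : ℝ) :
    service J σ i n t ≤ J.exec i n := by
  by_contra! hlt
  have hrt : J.release i n ≤ t := by
    by_contra! hr
    have := service_mono J σ i n hr.le
    rw [service_release] at this
    linarith [J.exec_nonneg i n]
  obtain ⟨u, hu, hue⟩ := intermediate_value_Icc hrt (service_continuous J σ i n).continuousOn
    (show J.exec i n ∈ Set.Icc _ _ from
      ⟨(service_release J σ i n).le.trans (J.exec_nonneg i n), hlt.le⟩)
  have : service J σ i n t ≤ service J σ i n u := by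
    refine measureReal_mono ?_ (measure_ne_top_of_subset (fun _ hs => hs.1)
      (by simp : volume (Set.Ico (J.release i n) u) ≠ ⊤))
    rintro s ⟨⟨h1, h2⟩, p, hp⟩
    refine ⟨⟨h1, ?_⟩, p, hp⟩
    by_contra! hus
    have h3 := (h.pending_of_run p s i n hp).2
    have h4 := service_mono J σ i n hus
    linarith
  linarith

theorem executed_add (h : IsGlobalFPSchedule J σ) (i : Fin N) {a b c : ℝ} (hab : a ≤ b)
    (hbc : b ≤ c) : executed σ i a b + executed σ i b c = executed σ i a c := by
  unfold executed
  rw [← Set.Ico_union_Ico_eq_Ico hab hbc, Set.inter_union_distrib_left, measureReal_union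
    ((Set.Ico_disjoint_Ico_same.mono Set.inter_subset_right Set.inter_subset_right))
    ((h.measurableSet_runSet i).inter measurableSet_Ico)
    (measureReal_inter_Ico_ne_top _ _ _) (measureReal_inter_Ico_ne_top _ _ _)]

/-- If only the jobs in `F` of task `i` are executed in `[a, b)`, then their service bounds the
execution of the task. -/
theorem executed_le_sum (h : IsGlobalFPSchedule J σ) (i : Fin N) {a b : ℝ} (F : Finset ℕ)
    (hF : ∀ p s n, s ∈ Set.Ico a b → σ p s = some (i, n) → n ∈ F) :
    executed σ i a b ≤ ∑ n ∈ F, service J σ i n b := by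
  refine le_trans ?_ (measureReal_biUnion_finset_le F _)
  refine measureReal_mono ?_ ?_
  · rintro s ⟨⟨p, n, hp⟩, hs⟩
    simp only [Set.mem_iUnion]
    exact ⟨n, hF p s n hs hp, ⟨(h.pending_of_run p s i n hp).1, hs.2⟩, p, hp⟩
  · refine ne_of_lt ((measure_biUnion_lt_top F.finite_toSet) fun n _ => ?_)
    exact (measure_ne_top_of_subset (fun _ hs => hs.1)
      (by simp : volume (Set.Ico (J.release i n) b) ≠ ⊤)).lt_top

/-- If all jobs of task `i` executed in `[a, b)` are released at or after `c ≤ a`, then the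
task executes for at most `work (b - c)` in this window. -/
theorem executed_le_work (h : IsGlobalFPSchedule J σ) (i : Fin N) {a b c : ℝ} (hca : c ≤ a)
    (hab : a ≤ b)
    (hrel : ∀ p s n, s ∈ Set.Ico a b → σ p s = some (i, n) → c ≤ J.release i n) :
    executed σ i a b ≤ (τ i).work (b - c) := by
  have hT := (τ i).T_pos
  have hex : ∃ n, c ≤ J.release i n := by
    obtain ⟨n, hn⟩ := exists_nat_ge ((c - J.release i 0) / (τ i).T)
    refine ⟨n, ?_⟩
    have := release_add_le J i 0 n
    rw [div_le_iff₀ hT] at hn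
    rw [zero_add] at this
    linarith
  classical
  set j := Nat.find hex with hj
  have hjc : c ≤ J.release i j := Nat.find_spec hex
  have hrem := (τ i).rem_nonneg (b - c)
  have hremT := (τ i).rem_lt (b - c)
  obtain ⟨K, hK⟩ : ∃ K : ℕ, ⌊(b - c) / (τ i).T⌋ = K :=
    Int.eq_ofNat_of_zero_le (Int.floor_nonneg.2 (div_nonneg (by linarith) hT.le))
  unfold SporadicTask.work
  rw [hK] at hrem hremT ⊢
  push_cast at hrem hremT ⊢
  have hrelK : c + K * (τ i).T ≤ J.release i (j + K) := by
    linarith [release_add_le J i j K]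
  -- Job `j + K` is the last that can run before `b`; released no earlier than `c + K T`, it has
  -- only the remainder of the window.
  have hlast : service J σ i (j + K) b ≤ min (τ i).C (b - c - K * (τ i).T) := by
    refine le_min ((h.service_le_exec i _ b).trans (J.exec_le i _)) ?_
    rcases le_total (J.release i (j + K)) b with hb | hb
    · have := service_le_add J σ i (j + K) hb
      rw [service_release] at this
      linarith
    · have := service_mono J σ i (j + K) hb
      rw [service_release] at this
      linarith
  have hsum := h.executed_le_sum i (a := a) (b := b) (Finset.Ico j (j + (K + 1))) (by
    intro p s n hs hp
    rw [Finset.mem_Ico]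
    refine ⟨Nat.find_min' hex (hrel p s n hs hp), ?_⟩
    by_contra! hn
    have h1 := release_add_le J i j (K + 1)
    have h2 := release_mono J i hn
    have h3 := (h.pending_of_run p s i n hp).1
    have h4 := hs.2
    push_cast at h1
    linarith)
  refine hsum.trans ?_
  rw [← add_assoc, Finset.sum_Ico_succ_top (by omega)]
  refine add_le_add ?_ hlast
  refine (Finset.sum_le_card_nsmul _ _ (τ i).C fun n _ =>
    (h.service_le_exec i n b).trans (J.exec_le i n)).trans ?_
  simp

theorem release_le_of_run (h : IsGlobalFPSchedule J σ) {i : Fin N} {m : ℕ}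
    (hm : ∀ j < m, ¬ Pending J σ i j (J.release i m)) {p : Fin M} {s : ℝ} {n : ℕ}
    (hs : J.release i m ≤ s) (hp : σ p s = some (i, n)) : m ≤ n := by
  by_contra! hnm
  refine hm n hnm ⟨release_mono J i hnm.le, ?_⟩
  exact (service_mono J σ i n hs).trans_lt (h.pending_of_run p s i n hp).2

/-- When an active task is not executed, at least `M` tasks of higher priority are. -/
theorem le_sum_indicator_of_active (h : IsGlobalFPSchedule J σ) {i k : Fin N} (hik : i ≤ k) {s : ℝ}
    (hact : Active J σ i s) (hrun : s ∉ runSet σ i) :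
    (M : ℝ) ≤ ∑ j ∈ Finset.Iio k, (runSet σ j).indicator (fun _ => (1 : ℝ)) s := by
  have h1 := (h.priority i s hact).resolve_left hrun
  choose f g hf hg using h1
  -- No task occupies two processors, so the `M` processors yield `M` distinct tasks.
  have hinj : Function.Injective f := by
    intro p q hpq
    have hq := hg q
    rw [← hpq] at hq
    exact h.sequential p q s _ _ _ (hg p) hq
  have := card_le_sum_indicator (σ := σ) k (Finset.univ.image f) (s := s) (by
      intro j hj
      obtain ⟨p, -, rfl⟩ := Finset.mem_image.1 hj
      exact Finset.mem_Iio.2 ((hf p).trans_le hik)) (by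
      intro j hj
      obtain ⟨p, -, rfl⟩ := Finset.mem_image.1 hj
      exact ⟨p, g p, hg p⟩)
  rwa [Finset.card_image_of_injective _ hinj, Finset.card_univ, Fintype.card_fin] at this

/-- Integration of a pointwise lower bound on the number of executed tasks. -/
theorem le_sum_executed (h : IsGlobalFPSchedule J σ) (i k : Fin N) {a b α β : ℝ} (hab : a ≤ b)
    (hc : ∀ s ∈ Set.Ico a b, α + β * (runSet σ i).indicator (fun _ => (1 : ℝ)) s ≤
      ∑ j ∈ Finset.Iio k, (runSet σ j).indicator (fun _ => (1 : ℝ)) s) :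
    α * (b - a) + β * executed σ i a b ≤ ∑ j ∈ Finset.Iio k, executed σ j a b := by
  have hint : ∀ j, IntegrableOn ((runSet σ j).indicator (fun _ => (1 : ℝ))) (Set.Ico a b) :=
    fun j => (integrableOn_const (by simp)).indicator (h.measurableSet_runSet j)
  have hval : ∀ j, ∫ s in Set.Ico a b, (runSet σ j).indicator (fun _ => (1 : ℝ)) s =
      executed σ j a b := by
    intro j
    rw [integral_indicator (h.measurableSet_runSet j)]
    simp [executed, measureReal_def, Measure.restrict_apply (h.measurableSet_runSet j)]
  have hconst : IntegrableOn (fun _ : ℝ => α) (Set.Ico a b) := integrableOn_const (by simp)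
  have := setIntegral_mono_on (hconst.add ((hint i).const_mul β))
    (integrable_finsetSum (Finset.Iio k) fun j _ => hint j) measurableSet_Ico
    (fun s hs => by simpa using hc s hs)
  simp only [Pi.add_apply] at this
  rw [integral_add hconst ((hint i).const_mul β), integral_const_mul, hval,
    integral_finsetSum _ fun j _ => hint j] at this
  simp only [hval] at this
  simpa [hab, mul_comm] using this

/-! ### Left extension of the window and the number of carry-in tasks. -/

/-- The earliest left end point that maximizes the surplus of the executed higher-priority work
over the rate `μ`. -/
theorem exists_maximal_extension (h : IsGlobalFPSchedule J σ) (k : Fin N) {μ : ℝ} (hμ : 0 < μ)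
    (r : ℝ) : ∃ t₀ ≤ r, μ * (r - t₀) ≤ ∑ i ∈ Finset.Iio k, executed σ i t₀ r ∧
      ∀ a < t₀, ∑ i ∈ Finset.Iio k, executed σ i a t₀ < μ * (t₀ - a) := by
  -- Nothing runs before `B`, so maximizing over the compact interval `[B, r]` is enough.
  obtain ⟨B, hBr, hB⟩ : ∃ B ≤ r, ∀ i, B ≤ J.release i 0 := by
    obtain ⟨B, hB⟩ := (Set.finite_range fun i => J.release i 0).bddBelow
    exact ⟨min B r, min_le_right _ _, fun i => (min_le_left _ _).trans (hB ⟨i, rfl⟩)⟩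
  have hidle : ∀ a i, executed σ i a B = 0 := by
    intro a i
    have : runSet σ i ∩ Set.Ico a B = ∅ := by
      rw [Set.eq_empty_iff_forall_notMem]
      rintro s ⟨⟨p, n, hp⟩, hs⟩
      have h1 := (h.pending_of_run p s i n hp).1
      have h2 := release_mono J i (Nat.zero_le n)
      linarith [hB i, hs.2]
    simp [executed, this]
  let g : ℝ → ℝ := fun t => μ * t - ∑ i ∈ Finset.Iio k, executed σ i B t
  have hg : Continuous g := (continuous_const.mul continuous_id).sub
    (continuous_finsetSum _ fun i _ => executed_continuous σ i B)
  have hsplit : ∀ a b, B ≤ a → a ≤ b → ∑ i ∈ Finset.Iio k, executed σ i a b =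
      μ * (b - a) + (g a - g b) := by
    intro a b hBa hab
    have : ∑ i ∈ Finset.Iio k, executed σ i B a + ∑ i ∈ Finset.Iio k, executed σ i a b =
        ∑ i ∈ Finset.Iio k, executed σ i B b := by
      rw [← Finset.sum_add_distrib]
      exact Finset.sum_congr rfl fun i _ => h.executed_add i hBa hab
    simp only [g]
    linarith
  obtain ⟨x, hx, hxmax⟩ := isCompact_Icc.exists_isMaxOn (Set.nonempty_Icc.2 hBr) hg.continuousOn
  have hcomp : IsCompact (Set.Icc B r ∩ g ⁻¹' {g x}) :=
    isCompact_Icc.inter_right (isClosed_singleton.preimage hg)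
  -- Taking the least maximizer makes the inequality to its left strict.
  obtain ⟨t₀, ⟨ht₀, hgt₀⟩, hleast⟩ := hcomp.exists_isLeast ⟨x, hx, rfl⟩
  have hgt₀ : g t₀ = g x := hgt₀
  refine ⟨t₀, ht₀.2, ?_, ?_⟩
  · rw [hsplit t₀ r ht₀.1 ht₀.2]
    have : g r ≤ g x := hxmax ⟨hBr, le_rfl⟩
    linarith
  · intro a ha
    have hlt : ∀ a, B ≤ a → a < t₀ → g a < g t₀ := by
      intro a hBa hat
      have har : a ∈ Set.Icc B r := ⟨hBa, hat.le.trans ht₀.2⟩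
      have h1 : g a ≤ g x := hxmax har
      refine hgt₀ ▸ h1.lt_of_ne fun heq => ?_
      exact absurd (hleast ⟨har, heq⟩) (not_le.2 hat)
    rcases le_total B a with hBa | haB
    · rw [hsplit a t₀ hBa ha.le]
      linarith [hlt a hBa ha]
    · have h1 : ∑ i ∈ Finset.Iio k, executed σ i a t₀ =
          ∑ i ∈ Finset.Iio k, executed σ i B t₀ := by
        refine Finset.sum_congr rfl fun i _ => ?_
        rw [← h.executed_add i haB ht₀.1, hidle, zero_add]
      rw [h1, hsplit B t₀ le_rfl ht₀.1]
      have h2 : μ * a ≤ μ * B := mul_le_mul_of_nonneg_left haB hμ.le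
      rcases haB.eq_or_lt with rfl | haB
      · linarith [hlt a le_rfl ha]
      · have h2 : μ * a < μ * B := mul_lt_mul_of_pos_left haB hμ
        have h3 : g B ≤ g t₀ := hgt₀ ▸ hxmax (a := B) ⟨le_rfl, hBr⟩
        linarith

/-- From the latest release among the carried-in jobs up to `t₀`, all tasks of `A` are active.
Either all of them run, or a waiting one forces `M ≥ μ` tasks to run; with `μ` or more tasks in `A`,
this window would reach the rate `μ`. -/
theorem card_lt_of_hasCarryIn (h : IsGlobalFPSchedule J σ) (k : Fin N) {μ t₀ : ℝ} (hμ : 0 < μ)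
    (hμM : μ ≤ M) (hlow : ∀ a < t₀, ∑ i ∈ Finset.Iio k, executed σ i a t₀ < μ * (t₀ - a))
    (A : Finset (Fin N)) (hA : A ⊆ Finset.Iio k) (hcarry : ∀ i ∈ A, HasCarryIn J σ i t₀) :
    (A.card : ℝ) < μ := by
  by_contra! hcard
  have hne : A.Nonempty := by
    rw [← Finset.card_pos, ← Nat.cast_pos (α := ℝ)]
    linarith
  choose! n hrel hpend using hcarry
  obtain ⟨q, hqA, hq⟩ := A.exists_max_image (fun i => J.release i (n i)) hne
  have hlt := hlow _ (hrel q hqA)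
  have := h.le_sum_executed k k (α := μ) (β := 0) (hrel q hqA).le (by
    intro s hs
    rw [zero_mul, add_zero]
    by_cases hall : ∀ i ∈ A, s ∈ runSet σ i
    · exact hcard.trans (card_le_sum_indicator k A hA hall)
    · push Not at hall
      obtain ⟨i, hiA, hi⟩ := hall
      refine hμM.trans (h.le_sum_indicator_of_active (Finset.mem_Iio.1 (hA hiA)).le ?_ hi)
      exact ⟨n i, (hq i hiA).trans hs.1,
        (service_mono J σ i (n i) hs.2.le).trans_lt (hpend i hiA).2⟩)
  linarith

/-! ### Workload bounds with and without carry-in. -/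

/-- While task `i ≤ k` is active, whenever it is not executed all processors are busy with tasks of
higher priority. -/
theorem le_sum_executed_of_active (h : IsGlobalFPSchedule J σ) {i k : Fin N} (hik : i ≤ k)
    {a b : ℝ} (hab : a ≤ b) (hact : ∀ t, a ≤ t → t < b → Active J σ i t) {c : ℝ}
    (hc : ∀ s ∈ runSet σ i,
      c ≤ ∑ j ∈ Finset.Iio k, (runSet σ j).indicator (fun _ => (1 : ℝ)) s) :
    M * (b - a) + (c - M) * executed σ i a b ≤ ∑ j ∈ Finset.Iio k, executed σ j a b := by
  refine h.le_sum_executed i k hab fun s hs => ?_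
  by_cases hrun : s ∈ runSet σ i
  · simpa [hrun] using hc s hrun
  · simpa [hrun] using h.le_sum_indicator_of_active hik (hact s hs.1 hs.2) hrun

theorem executed_le_work_of_not_hasCarryIn (h : IsGlobalFPSchedule J σ) {i : Fin N} {a b : ℝ}
    (hab : a ≤ b) (hcarry : ¬ HasCarryIn J σ i a) : executed σ i a b ≤ (τ i).work (b - a) := by
  refine h.executed_le_work i le_rfl hab fun p s n hs hp => ?_
  by_contra! hn
  exact hcarry ⟨n, hn, hn.le, (service_mono J σ i n hs.1).trans_lt (h.pending_of_run p s i n hp).2⟩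

/-- A job running at or after `a` was released after `a - D`, because otherwise its deadline has
passed and it is finished. -/
theorem executed_le_omegaHeavy (h : IsGlobalFPSchedule J σ) {i : Fin N} {a b : ℝ} (hab : a ≤ b)
    (hmeet : MeetsDeadlines J σ i) : executed σ i a b ≤ (τ i).omegaHeavy (b - a) := by
  have := h.executed_le_work i (a := a) (b := b) (c := a - (τ i).D)
    (by linarith [(τ i).D_pos]) hab (fun p s n hs hp => by
      by_contra! hn
      have h1 := (h.pending_of_run p s i n hp).2
      have h2 := service_mono J σ i n (show J.release i n + (τ i).D ≤ s by linarith [hs.1])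
      linarith [hmeet n])
  unfold SporadicTask.omegaHeavy
  rwa [show b - a + (τ i).D = b - (a - (τ i).D) by ring]

theorem executed_le_omegaLight (h : IsGlobalFPSchedule J σ) (hM : 2 ≤ M) {i k : Fin N} (hik : i < k)
    {t₀ b ρ : ℝ} (hb : t₀ ≤ b) (hρ : ρ ≤ 1) (hU : (τ i).U ≤ ρ)
    (hlow : ∀ a < t₀, ∑ i ∈ Finset.Iio k, executed σ i a t₀ < mu M ρ * (t₀ - a))
    (hcarry : HasCarryIn J σ i t₀) : executed σ i t₀ b ≤ (τ i).omegaLight (b - t₀) ρ := by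
  by_cases hC : b - t₀ ≤ (τ i).C
  · rw [SporadicTask.omegaLight, if_pos hC]
    exact executed_le i hb
  obtain ⟨n, hn, hpend⟩ := hcarry
  obtain ⟨m, hmn, hm, hact⟩ := exists_busy_period J σ i n (b := t₀) fun t ht htb =>
    ⟨ht, (service_mono J σ i n htb.le).trans_lt hpend.2⟩
  have hφ : J.release i m < t₀ := (release_mono J i hmn).trans_lt hn
  -- While task `i` runs, it counts itself among the tasks above `k`, hence `c = 1`.
  have h1 := h.le_sum_executed_of_active hik.le hφ.le hact (c := 1) (fun s hs => by
    simpa using card_le_sum_indicator (σ := σ) k {i} (by simpa using hik) (by simpa using hs))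
  have h2 := hlow _ hφ
  have h3 := h.executed_le_work i (a := J.release i m) (b := b) (c := J.release i m) le_rfl
    (by linarith) fun p s j hs hp => release_mono J i (h.release_le_of_run hm hs.1 hp)
  rw [← h.executed_add i hφ.le hb] at h3
  have h4 := (τ i).work_add_le_omegaLight (L := t₀ - J.release i m) (not_le.1 hC) (by linarith)
    hU hρ
  rw [show b - t₀ + (t₀ - J.release i m) = b - J.release i m by ring] at h4
  -- With `L` the length and `e` the execution of `i`, `M L - (M - 1) e < μ L = M L - (M - 1) ρ L`;
  -- divide by `M - 1 > 0`.
  have h5 : ρ * (t₀ - J.release i m) ≤ executed σ i (J.release i m) t₀ := by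
    have hM' : (0 : ℝ) < M - 1 := by
      have : (2 : ℝ) ≤ M := by exact_mod_cast hM
      linarith
    refine le_of_mul_le_mul_left ?_ hM'
    unfold mu at h2
    linarith
  linarith

/-! ### The contradiction from a missed deadline. -/

/-- The busy period of a job that misses its deadline contains more higher-priority work than the
rate `mu` allows. -/
theorem executed_lt_of_miss (h : IsGlobalFPSchedule J σ) {k : Fin N} {m n : ℕ} (hmn : m ≤ n)
    (hm : ∀ j < m, ¬ Pending J σ k j (J.release k m))
    (hmiss : service J σ k n (J.release k n + (τ k).D) < J.exec k n) :
    executed σ k (J.release k m) (J.release k n + (τ k).D) < (n - m + 1 : ℕ) * (τ k).C := by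
  have h1 := h.executed_le_sum k (a := J.release k m) (b := J.release k n + (τ k).D)
    (Finset.Ico m (n + 1)) (by
      intro p s j hs hp
      refine Finset.mem_Ico.2 ⟨h.release_le_of_run hm hs.1 hp, ?_⟩
      by_contra! hj
      have h2 := (h.pending_of_run p s k j hp).1
      -- Job `n` is unfinished up to its deadline, so no later job of `k` may run before then.
      refine h.fifo p s k j n hp hj ⟨(release_mono J k (by omega)).trans h2, ?_⟩
      exact (service_mono J σ k n hs.2.le).trans_lt hmiss)
  refine h1.trans_lt ?_
  have h2 : ∑ j ∈ Finset.Ico m (n + 1), service J σ k j (J.release k n + (τ k).D) <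
      ∑ _j ∈ Finset.Ico m (n + 1), (τ k).C :=
    Finset.sum_lt_sum (fun j _ => (h.service_le_exec k j _).trans (J.exec_le k j))
      ⟨n, by simp [hmn], hmiss.trans_le (J.exec_le k n)⟩
  rwa [Finset.sum_const, Nat.card_Ico, nsmul_eq_mul, Nat.sub_add_comm hmn] at h2

/-- If the test holds for the number of jobs in the busy period, its last job does not miss its
deadline. -/
theorem not_miss_of_testCondition (h : IsGlobalFPSchedule J σ) (hM : 2 ≤ M) {k : Fin N}
    (hmeet : ∀ i < k, MeetsDeadlines J σ i) {m n : ℕ} (hmn : m ≤ n)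
    (hm : ∀ j < m, ¬ Pending J σ k j (J.release k m))
    (hact : ∀ t, J.release k m ≤ t → t < J.release k n + (τ k).D → Active J σ k t)
    (htest : TestCondition M τ k (n - m + 1)) :
    J.exec k n ≤ service J σ k n (J.release k n + (τ k).D) := by
  by_contra! hmiss
  have hX := h.executed_lt_of_miss hmn hm hmiss
  set d := J.release k n + (τ k).D with hd
  set r := J.release k m
  set ℓ := n - m + 1 with hℓ
  obtain ⟨ρ, hρlow, hρ1, htest⟩ := htest
  have hM2 : (2 : ℝ) ≤ M := by exact_mod_cast hM
  have hℓ1 : (1 : ℝ) ≤ ℓ := by exact_mod_cast (show 1 ≤ ℓ by omega)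
  have hlen : ((ℓ : ℝ) - 1) * (τ k).T + (τ k).D ≤ d - r := by
    have := release_add_le J k m (n - m)
    rw [Nat.add_sub_of_le hmn] at this
    rw [hℓ]
    push_cast
    linarith
  have hden : 0 < ((ℓ : ℝ) - 1) * (τ k).T + (τ k).D :=
    add_pos_of_nonneg_of_pos (mul_nonneg (by linarith) (τ k).T_pos.le) (τ k).D_pos
  have hℓC : 0 < (ℓ : ℝ) * (τ k).C := mul_pos (by linarith) (τ k).C_pos
  have hρ0 : 0 < ρ := (div_pos hℓC hden).trans_le hρlow
  rw [div_le_iff₀ hden] at hρlow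
  have hρd : (ℓ : ℝ) * (τ k).C ≤ ρ * (d - r) :=
    hρlow.trans (mul_le_mul_of_nonneg_left hlen hρ0.le)
  have hrd : r < d := by linarith
  have hμ0 : 0 < mu M ρ := by
    unfold mu
    have := mul_le_mul_of_nonneg_left hρ1 (show (0 : ℝ) ≤ M - 1 by linarith)
    linarith
  have hμM : mu M ρ ≤ M := by
    unfold mu
    have := mul_nonneg (show (0 : ℝ) ≤ M - 1 by linarith) hρ0.le
    linarith
  -- Task `k` is not in `Iio k`, so nothing is guaranteed while it runs: `c = 0`.
  have hbusy := h.le_sum_executed_of_active le_rfl hrd.le hact (c := 0) fun s _ =>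
    Finset.sum_nonneg fun j _ => Set.indicator_nonneg (fun _ _ => zero_le_one) s
  obtain ⟨t₀, ht₀r, hext, hlow⟩ := h.exists_maximal_extension k hμ0 r
  have ht₀d : t₀ < d := ht₀r.trans_lt hrd
  obtain ⟨S, hS, hle⟩ := htest (d - t₀) (by linarith)
  classical
  set A := (Finset.Iio k).filter fun i => HasCarryIn J σ i t₀ with hA
  have hAk : A ⊆ Finset.Iio k := Finset.filter_subset _ _
  have hcard : A.card ≤ ⌈mu M ρ⌉₊ - 1 := Nat.le_sub_one_of_lt <| Nat.lt_ceil.2 <|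
    h.card_lt_of_hasCarryIn k hμ0 hμM hlow A hAk fun i hi => (Finset.mem_filter.1 hi).2
  have hAS := hS.sum_le (by linarith) hAk hcard
  have hcarry : ∀ i ∈ A, executed σ i t₀ d ≤
      (τ i).omegaDiff (d - t₀) ρ + (τ i).work (d - t₀) := by
    intro i hi
    obtain ⟨hik, hc⟩ := Finset.mem_filter.1 hi
    have hik := Finset.mem_Iio.1 hik
    unfold SporadicTask.omegaDiff
    split_ifs with hU
    · rw [sub_add_cancel]
      exact h.executed_le_omegaHeavy ht₀d.le (hmeet i hik)
    · rw [sub_add_cancel]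
      exact h.executed_le_omegaLight hM hik ht₀d.le hρ1 (not_lt.1 hU) hlow hc
  have htotal : ∑ i ∈ Finset.Iio k, executed σ i t₀ d ≤
      ∑ i ∈ A, (τ i).omegaDiff (d - t₀) ρ + ∑ i ∈ Finset.Iio k, (τ i).work (d - t₀) := by
    rw [hA, Finset.sum_filter, ← Finset.sum_add_distrib]
    refine Finset.sum_le_sum fun i hi => ?_
    split_ifs with hc
    · exact hcarry i (Finset.mem_filter.2 ⟨hi, hc⟩)
    · rw [zero_add]
      exact h.executed_le_work_of_not_hasCarryIn ht₀d.le hc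
  have hsplit : ∑ i ∈ Finset.Iio k, executed σ i t₀ r + ∑ i ∈ Finset.Iio k, executed σ i r d =
      ∑ i ∈ Finset.Iio k, executed σ i t₀ d := by
    rw [← Finset.sum_add_distrib]
    exact Finset.sum_congr rfl fun i _ => h.executed_add i ht₀r hrd.le
  have hfin : mu M ρ * (d - r) <
      ∑ i ∈ Finset.Iio k, executed σ i r d + (ℓ : ℝ) * (τ k).C := by
    -- If `X` is the execution of `k`, then `X ≤ ρ (d - r)` gives `μ (d - r) ≤ M (d - r) - (M - 1)
    -- X`, which is at most the higher-priority execution plus `X`.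
    have h1 := mul_le_mul_of_nonneg_left (hX.le.trans hρd) (show (0 : ℝ) ≤ M - 1 by linarith)
    unfold mu
    linarith
  linarith

end IsGlobalFPSchedule

end Schedule

end GlobalFP

theorem theorem3p10 {N : ℕ} (M : ℕ) (hM : 2 ≤ M) (τ : Fin N → GlobalFP.SporadicTask) (k : Fin N)
    (hhp : ∀ i : Fin N, i < k → GlobalFP.Schedulable M τ i) :
    ((∀ ℓ : ℕ, 1 ≤ ℓ → GlobalFP.TestCondition M τ k ℓ) → GlobalFP.Schedulable M τ k) ∧
    ((τ k).D ≤ (τ k).T → GlobalFP.TestCondition M τ k 1 → GlobalFP.Schedulable M τ k) := by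
  open GlobalFP in
  constructor
  · intro htest J σ h n
    by_contra! hmiss
    obtain ⟨m, hmn, hm, hact⟩ := exists_busy_period J σ k n
      (b := J.release k n + (τ k).D) fun t ht htb =>
        ⟨ht, (service_mono J σ k n htb.le).trans_lt hmiss⟩
    exact hmiss.not_ge (h.not_miss_of_testCondition hM (fun i hi => hhp i hi J σ h) hmn hm hact
      (htest _ (by omega)))
  · intro hDT htest J σ h n
    induction n using Nat.strong_induction_on with
    | _ n ih =>
      by_contra! hmiss
      refine hmiss.not_ge (h.not_miss_of_testCondition hM (fun i hi => hhp i hi J σ h) le_rfl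
        ?_ ?_ (by simpa using htest))
      -- Job `j` meets its deadline by induction, and `D ≤ T` puts that deadline no later than the
      -- release of job `n`; the busy period may start at `n` itself.
      · intro j hj hpend
        have h1 := release_mono J k (show j + 1 ≤ n from hj)
        have h2 := J.release_succ k j
        have h3 := service_mono J σ k j
          (show J.release k j + (τ k).D ≤ J.release k n by linarith)
        linarith [ih j hj, hpend.2]
      · exact fun t ht htb => ⟨n, ht, (service_mono J σ k n htb.le).trans_lt hmiss⟩
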